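/- **Theorem.** Let $\mathbb{H}$ be a complex Hilbert space and let $T$ be a bounded linear operator on $\mathbb{H}$. Write $w(S)=\sup\{|\langle Sx,x\rangle| : x\in\mathbb{H},\ \|x\|=1\}$ for the numerical radius of a bounded operator $S$ (with $w(S)=0$ if $\mathbb{H}=\{0\}$). Let $|S|=(S^*S)^{1/2}$ and let $U_S$ be the partial isometry of the polar decomposition of $S$, i.e. $S=U_S|S|$ and $\ker U_S=\ker S$. For $t\in[0,1]$ the $t$-Aluthge transform of $S$ is $$\widetilde{S}_t=|S|^{t}\,U_S\,|S|^{1-t},\qquad\text{where } |S|^0 \text{ is understood as } U_S^*U_S .$$ For fixed $t\in[0,1]$ the iterated $t$-Aluthge transforms of $T$ are defined by $\widetilde{T}_{t_0}=T$ and $\widetilde{T}_{t_n}=\widetilde{(\widetilde{T}_{t_{n-1}})}_t$ for $n\ge 1$ (the same $t$ at every step). Then for every $t\in[0,1]$ the series below converges and $$w(T)^2\le\sum_{n=1}^{\infty}\frac{1}{4^n}\Big(\|\widetilde{T}_{t_{n-1}}\|\,\|\widetilde{T}_{t_n}\|+\big\|\widetilde{T}_{t_{n-1}}^*\widetilde{T}_{t_{n-1}}+\widetilde{T}_{t_{n-1}}\widetilde{T}_{t_{n-1}}^*\big\|\Big).$$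 -/

import Mathlib

open scoped InnerProductSpace

namespace AluthgeIteration

variable {H : Type*} [NormedAddCommGroup H] [InnerProductSpace ℂ H]

/-- The numerical range `W(T) = {⟨Tx, x⟩ : ‖x‖ = 1}`. In Mathlib the inner product is linear in
its second argument, so `⟨Tx, x⟩` is written `⟪x, T x⟫_ℂ`. -/
def numericalRange (T : H →L[ℂ] H) : Set ℂ :=
  {c | ∃ x : H, ‖x‖ = 1 ∧ c = ⟪x, T x⟫_ℂ}

/-- The numerical radius `w(T) = sup {|c| : c ∈ W(T)}` (it is `0` when `H` is the zero space). -/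
noncomputable def numericalRadius (T : H →L[ℂ] H) : ℝ :=
  sSup ((fun c : ℂ => ‖c‖) '' numericalRange T)

/-- The set of which `w(T)` is the supremum is bounded, so the supremum is not a junk value. -/
theorem numericalRange_bddAbove (T : H →L[ℂ] H) :
    BddAbove ((fun c : ℂ => ‖c‖) '' numericalRange T) := by
  refine ⟨‖T‖, ?_⟩
  rintro _ ⟨c, ⟨x, hx, rfl⟩, rfl⟩
  calc ‖⟪x, T x⟫_ℂ‖ ≤ ‖x‖ * ‖T x‖ := norm_inner_le_norm _ _
    _ ≤ ‖x‖ * (‖T‖ * ‖x‖) := by gcongr; exact T.le_opNorm x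
    _ = ‖T‖ := by rw [hx]; ring

variable [CompleteSpace H]

/-- `U` is the partial isometry of the polar decomposition of `T`: `U` is isometric on the
orthogonal complement of its kernel, `T = U|T|` with `|T| = (T* T)^{1/2}`, and `ker U = ker T`. -/
structure IsPolarPart (T U : H →L[ℂ] H) : Prop where
  isometric : ∀ x ∈ U.kerᗮ, ‖U x‖ = ‖x‖
  factor : T = U * CFC.abs T
  ker_eq : U.ker = T.ker

/-- `‖ |T| x ‖ = ‖T x‖`. -/
theorem norm_abs_apply (T : H →L[ℂ] H) (x : H) : ‖CFC.abs T x‖ = ‖T x‖ := by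
  have hsa : star (CFC.abs T) = CFC.abs T := (CFC.abs_nonneg T).isSelfAdjoint.star_eq
  have h : star (CFC.abs T) * CFC.abs T = star T * T := by rw [hsa, CFC.abs_mul_abs]
  have h1 : ⟪CFC.abs T x, CFC.abs T x⟫_ℂ = ⟪T x, T x⟫_ℂ := by
    rw [← ContinuousLinearMap.adjoint_inner_right, ← ContinuousLinearMap.adjoint_inner_right]
    exact congrArg (fun S : H →L[ℂ] H => ⟪x, S x⟫_ℂ) h
  rw [inner_self_eq_norm_sq_to_K, inner_self_eq_norm_sq_to_K] at h1
  have h2 : ‖CFC.abs T x‖ ^ 2 = ‖T x‖ ^ 2 := by exact_mod_cast h1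
  exact (sq_eq_sq₀ (norm_nonneg _) (norm_nonneg _)).mp h2

/-- `ker |T| = ker T`. -/
theorem ker_abs (T : H →L[ℂ] H) : (CFC.abs T).ker = T.ker := by
  ext x
  simp only [LinearMap.mem_ker, ContinuousLinearMap.coe_coe]
  rw [← norm_eq_zero, norm_abs_apply, norm_eq_zero]

/-- `(ran |T|)^⊥ = ker T`. -/
theorem orthogonal_range_abs (T : H →L[ℂ] H) : (CFC.abs T).rangeᗮ = T.ker := by
  rw [ContinuousLinearMap.orthogonal_range]
  have hsa : ContinuousLinearMap.adjoint (CFC.abs T) = CFC.abs T :=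
    (CFC.abs_nonneg T).isSelfAdjoint.star_eq
  rw [hsa, ker_abs]

/-- Every bounded operator has a polar decomposition. -/
theorem exists_isPolarPart (T : H →L[ℂ] H) : ∃ U : H →L[ℂ] H, IsPolarPart T U := by
  let K : Submodule ℂ H := (CFC.abs T).range.topologicalClosure
  have hKc : IsClosed (K : Set H) := Submodule.isClosed_topologicalClosure _
  have : CompleteSpace K := hKc.completeSpace_coe
  have hmem : ∀ x, (CFC.abs T).toLinearMap x ∈ K := fun x =>
    Submodule.le_topologicalClosure _ (LinearMap.mem_range_self _ x)
  let e : H →ₗ[ℂ] K := (CFC.abs T).toLinearMap.codRestrict K hmem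
  have hdense : DenseRange e := by
    intro y
    rw [closure_subtype]
    have hy : (y : H) ∈ closure ((CFC.abs T).range : Set H) := y.2
    refine closure_mono ?_ hy
    rintro _ ⟨x, rfl⟩
    exact ⟨e x, ⟨x, rfl⟩, rfl⟩
  have hnorm : ∀ x, ‖T x‖ = ‖e x‖ := fun x => (norm_abs_apply T x).symm
  let V : K →L[ℂ] H := T.toLinearMap.extendOfNorm e
  have hV : ∀ x, V (e x) = T x := fun x =>
    LinearMap.extendOfNorm_eq (f := T.toLinearMap) hdense
      ⟨1, fun x => by rw [one_mul]; exact (hnorm x).le⟩ x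
  have hViso : ∀ y, ‖V y‖ = ‖y‖ := by
    intro y
    refine hdense.induction (P := fun y => ‖V y‖ = ‖y‖) ?_ ?_ y
    · rintro _ ⟨x, rfl⟩
      rw [hV, hnorm]
    · exact isClosed_eq (by fun_prop) (by fun_prop)
  have hKorth : Kᗮ = T.ker := by
    rw [Submodule.orthogonal_closure, orthogonal_range_abs]
  let U : H →L[ℂ] H := V ∘L K.orthogonalProjectionOnto
  have hker : U.ker = T.ker := by
    rw [← hKorth]
    ext x
    rw [← Submodule.orthogonalProjectionOnto_eq_zero_iff]
    change V (K.orthogonalProjectionOnto x) = 0 ↔ _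
    rw [← norm_eq_zero, hViso, norm_eq_zero]
  refine ⟨U, ?_, ?_, hker⟩
  · intro x hx
    rw [hker, ← hKorth, Submodule.orthogonal_orthogonal] at hx
    change ‖V (K.orthogonalProjectionOnto x)‖ = ‖x‖
    rw [hViso]
    exact congrArg (fun y : K => ‖y‖)
      (Submodule.orthogonalProjectionOnto_mem_subspace_eq_self (⟨x, hx⟩ : K))
  · ext x
    change T x = V (K.orthogonalProjectionOnto (CFC.abs T x))
    have : K.orthogonalProjectionOnto (CFC.abs T x) = e x :=
      Submodule.orthogonalProjectionOnto_mem_subspace_eq_self (e x)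
    rw [this, hV]

/-- The partial isometry of the polar decomposition is unique. -/
theorem IsPolarPart.unique {T U V : H →L[ℂ] H} (hU : IsPolarPart T U) (hV : IsPolarPart T V) :
    U = V := by
  have hle : (CFC.abs T).range.topologicalClosure ≤ (U - V).ker := by
    refine Submodule.topologicalClosure_minimal _ ?_ (U - V).isClosed_ker
    rintro _ ⟨x, rfl⟩
    have h1 : T x = U (CFC.abs T x) := congrArg (fun S : H →L[ℂ] H => S x) hU.factor
    have h2 : T x = V (CFC.abs T x) := congrArg (fun S : H →L[ℂ] H => S x) hV.factor
    change U (CFC.abs T x) - V (CFC.abs T x) = 0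
    rw [← h1, ← h2, sub_self]
  have hle' : (CFC.abs T).rangeᗮ ≤ (U - V).ker := by
    rw [orthogonal_range_abs]
    intro x hx
    have h1 : x ∈ U.ker := by rw [hU.ker_eq]; exact hx
    have h2 : x ∈ V.ker := by rw [hV.ker_eq]; exact hx
    change U x - V x = 0
    rw [show U x = 0 from h1, show V x = 0 from h2, sub_self]
  have : CompleteSpace (CFC.abs T).range.topologicalClosure :=
    (Submodule.isClosed_topologicalClosure _).completeSpace_coe
  have htop : (⊤ : Submodule ℂ H) ≤ (U - V).ker := by
    rw [← Submodule.sup_orthogonal_of_hasOrthogonalProjection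
      (K := (CFC.abs T).range.topologicalClosure)]
    refine sup_le hle ?_
    rw [Submodule.orthogonal_closure]
    exact hle'
  ext x
  exact sub_eq_zero.mp (show (U - V) x = 0 from htop (Submodule.mem_top (x := x)))

/-- The partial isometry `U` of the polar decomposition `T = U|T|`, `ker U = ker T`. -/
noncomputable def polarPart (T : H →L[ℂ] H) : H →L[ℂ] H :=
  Classical.choose (exists_isPolarPart T)

theorem isPolarPart_polarPart (T : H →L[ℂ] H) : IsPolarPart T (polarPart T) :=
  Classical.choose_spec (exists_isPolarPart T)

open Classical in
/-- The power `|T|^s`, `s ≥ 0`, with the convention `|T|^0 = U* U`. -/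
noncomputable def absPow (T : H →L[ℂ] H) (s : ℝ) : H →L[ℂ] H :=
  if s = 0 then star (polarPart T) * polarPart T else CFC.abs T ^ s

/-- The `t`-Aluthge transform `|T|^t U |T|^{1-t}`. -/
noncomputable def aluthge (t : ℝ) (T : H →L[ℂ] H) : H →L[ℂ] H :=
  absPow T t * polarPart T * absPow T (1 - t)

/-- The `n`-th iterated `t`-Aluthge transform; the `0`-th is `T` itself. -/
noncomputable def iteratedAluthge (t : ℝ) (T : H →L[ℂ] H) : ℕ → (H →L[ℂ] H)
  | 0 => T
  | n + 1 => aluthge t (iteratedAluthge t T n)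

/-- The summand `4^{-n} (‖T_{n-1}‖ ‖T_n‖ + ‖T_{n-1}* T_{n-1} + T_{n-1} T_{n-1}*‖)`, where `T_n` is
the `n`-th iterated `t`-Aluthge transform and `n = k + 1`, so that `k` runs through
`0, 1, 2, …` as `n` runs through `1, 2, 3, …`. -/
noncomputable def iterateTerm (t : ℝ) (T : H →L[ℂ] H) (k : ℕ) : ℝ :=
  1 / 4 ^ (k + 1) *
    (‖iteratedAluthge t T k‖ * ‖iteratedAluthge t T (k + 1)‖ +
      ‖star (iteratedAluthge t T k) * iteratedAluthge t T k +
        iteratedAluthge t T k * star (iteratedAluthge t T k)‖)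

end AluthgeIteration

namespace AluthgeIteration

section

variable {H : Type*} [NormedAddCommGroup H] [InnerProductSpace ℂ H]

/-! ### The numerical radius as a quadratic form bound -/

/-! One step of the iteration is `4 w(T)² ≤ w(T̃)² + ‖T‖‖T̃‖ + ‖T*T + TT*‖`, where `T̃` is the
`t`-Aluthge transform. Expanding the square of the real part of a rotated `T` gives `4 w(T)² ≤ 2
w(T²) + ‖T*T + TT*‖` (`four_mul_sq_numericalRadius_le`). The link with `T̃` is the commutation
inequality `2 w(AB) ≤ w(BA) + ‖A‖‖B‖` (`two_mul_numericalRadius_mul_le`): with `A = U|T|^{1-t} T̃`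
and `B = |T|^t` one has `AB = T²` and `BA = T̃²`, while `w(T̃²) ≤ w(T̃)²`.

Dividing by 4 and iterating `n` times leaves the remainder `4^{-n} w(T_n)²`. Since the transform
does not increase the norm, this is at most `4^{-n}‖T‖²`, and the same bound on norms makes the
series converge. -/

theorem norm_inner_le_numericalRadius (T : H →L[ℂ] H) (x : H) :
    ‖⟪x, T x⟫_ℂ‖ ≤ numericalRadius T * ‖x‖ ^ 2 := by
  rcases eq_or_ne x 0 with rfl | hx
  · simp
  have hx' : ‖x‖ ≠ 0 := norm_ne_zero_iff.mpr hx
  let y : H := ((‖x‖⁻¹ : ℝ) : ℂ) • x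
  have hy : ‖y‖ = 1 := by
    simp [y, norm_smul, hx']
  have h : ‖⟪y, T y⟫_ℂ‖ ≤ numericalRadius T :=
    le_csSup (numericalRange_bddAbove T) ⟨_, ⟨y, hy, rfl⟩, rfl⟩
  have hxy : x = ((‖x‖ : ℝ) : ℂ) • y := by
    simp [y, smul_smul, hx']
  have e : ‖⟪x, T x⟫_ℂ‖ = ‖x‖ ^ 2 * ‖⟪y, T y⟫_ℂ‖ := by
    conv_lhs => rw [hxy]
    simp only [map_smul, inner_smul_left, inner_smul_right, norm_mul, Complex.conj_ofReal,
      Complex.norm_real, norm_norm]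
    ring
  rw [e, mul_comm]
  gcongr

theorem numericalRadius_nonneg (T : H →L[ℂ] H) : 0 ≤ numericalRadius T := by
  refine Real.sSup_nonneg ?_
  rintro _ ⟨c, -, rfl⟩
  exact norm_nonneg c

theorem numericalRadius_le {T : H →L[ℂ] H} {m : ℝ} (hm : 0 ≤ m)
    (h : ∀ x, ‖⟪x, T x⟫_ℂ‖ ≤ m * ‖x‖ ^ 2) : numericalRadius T ≤ m := by
  refine Real.sSup_le ?_ hm
  rintro _ ⟨c, ⟨x, hx, rfl⟩, rfl⟩
  simpa [hx] using h x

theorem norm_inner_apply_le (T : H →L[ℂ] H) (x : H) :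
    ‖⟪x, T x⟫_ℂ‖ ≤ ‖T‖ * ‖x‖ ^ 2 := by
  calc ‖⟪x, T x⟫_ℂ‖ ≤ ‖x‖ * ‖T x‖ := norm_inner_le_norm _ _
    _ ≤ ‖x‖ * (‖T‖ * ‖x‖) := by gcongr; exact T.le_opNorm x
    _ = ‖T‖ * ‖x‖ ^ 2 := by ring

theorem numericalRadius_le_norm (T : H →L[ℂ] H) : numericalRadius T ≤ ‖T‖ :=
  numericalRadius_le (norm_nonneg T) (norm_inner_apply_le T)

theorem exists_unit_mul_eq_norm (z : ℂ) : ∃ u : ℂ, ‖u‖ = 1 ∧ u * z = (‖z‖ : ℂ) := by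
  rcases eq_or_ne z 0 with rfl | hz
  · exact ⟨1, by simp⟩
  · have hz' : (‖z‖ : ℂ) ≠ 0 := by exact_mod_cast norm_ne_zero_iff.mpr hz
    refine ⟨‖z‖ / z, ?_, ?_⟩
    · rw [norm_div, Complex.norm_real, norm_norm, div_self (norm_ne_zero_iff.mpr hz)]
    · field_simp

theorem exists_sq_unit_mul_eq_norm (z : ℂ) : ∃ u : ℂ, ‖u‖ = 1 ∧ u ^ 2 * z = (‖z‖ : ℂ) := by
  obtain ⟨v, hv, h⟩ := exists_unit_mul_eq_norm z
  obtain ⟨u, hu⟩ := IsSquare.exists_sq v (IsAlgClosed.exists_eq_mul_self v)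
  refine ⟨u, ?_, by rw [← hu, h]⟩
  rw [hu, norm_pow] at hv
  exact (pow_eq_one_iff_of_nonneg (norm_nonneg u) two_ne_zero).mp hv

/-- A quadratic-form version of `m² - T² = (m - T)(m + T)`: testing the hypothesis on `mx ± Tx` and
adding, the terms in `‖Tx‖²` cancel. -/
theorem re_inner_apply_apply_le {T : H →L[ℂ] H} {m : ℝ} (hm : 0 < m)
    (h : ∀ x, ‖⟪x, T x⟫_ℂ‖ ≤ m * ‖x‖ ^ 2) (x : H) :
    (⟪x, T (T x)⟫_ℂ).re ≤ m ^ 2 * ‖x‖ ^ 2 := by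
  let u : H := (m : ℂ) • x + T x
  let v : H := (m : ℂ) • x - T x
  have hu : 0 ≤ m * ‖u‖ ^ 2 - (⟪u, T u⟫_ℂ).re := by
    linarith [h u, Complex.re_le_norm ⟪u, T u⟫_ℂ]
  have hv : 0 ≤ m * ‖v‖ ^ 2 + (⟪v, T v⟫_ℂ).re := by
    linarith [h v, Complex.abs_re_le_norm ⟪v, T v⟫_ℂ, neg_abs_le (⟪v, T v⟫_ℂ).re]
  have nsq : ∀ y : H, ‖y‖ ^ 2 = (⟪y, y⟫_ℂ).re := fun y => (inner_self_eq_norm_sq (𝕜 := ℂ) y).symm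
  have key : (m * ‖u‖ ^ 2 - (⟪u, T u⟫_ℂ).re) + (m * ‖v‖ ^ 2 + (⟪v, T v⟫_ℂ).re)
      = 2 * m * (m ^ 2 * ‖x‖ ^ 2 - (⟪x, T (T x)⟫_ℂ).re) := by
    simp only [nsq, u, v, map_add, map_sub, map_smul, inner_add_left, inner_add_right,
      inner_sub_left, inner_sub_right, inner_smul_left, inner_smul_right, Complex.conj_ofReal,
      Complex.add_re, Complex.sub_re, Complex.re_ofReal_mul]
    ring
  have : 0 ≤ 2 * m * (m ^ 2 * ‖x‖ ^ 2 - (⟪x, T (T x)⟫_ℂ).re) := by rw [← key]; positivity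
  linarith [nonneg_of_mul_nonneg_right this (by positivity)]

theorem numericalRadius_mul_self_le (T : H →L[ℂ] H) :
    numericalRadius (T * T) ≤ numericalRadius T ^ 2 := by
  refine numericalRadius_le (sq_nonneg _) fun x => ?_
  obtain ⟨u, hu, hux⟩ := exists_sq_unit_mul_eq_norm ⟪x, (T * T) x⟫_ℂ
  -- The previous bound divides by `m`, and `w(T)` may be `0`; hence the limit `m ↓ w(T)`. Rotating
  -- `T` by a square root of the required phase turns the real part into a modulus.
  have h : ∀ m, numericalRadius T < m → ‖⟪x, (T * T) x⟫_ℂ‖ ≤ m ^ 2 * ‖x‖ ^ 2 := by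
    intro m hm
    have := re_inner_apply_apply_le (T := u • T) ((numericalRadius_nonneg T).trans_lt hm)
      (fun y => by
        simp only [smul_apply, inner_smul_right, norm_mul, hu, one_mul]
        exact (norm_inner_le_numericalRadius T y).trans (by gcongr)) x
    have e : ⟪x, (u • T) ((u • T) x)⟫_ℂ = (‖⟪x, (T * T) x⟫_ℂ‖ : ℂ) := by
      rw [← hux]
      simp only [smul_apply, map_smul, inner_smul_right,
        mul_apply_eq_comp]
      ring
    rwa [e, Complex.ofReal_re] at this
  refine ge_of_tendsto (f := fun m : ℝ => m ^ 2 * ‖x‖ ^ 2)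
    (x := nhdsWithin (numericalRadius T) (Set.Ioi (numericalRadius T))) ?_ ?_
  · exact ((by fun_prop : Continuous fun m : ℝ => m ^ 2 * ‖x‖ ^ 2).tendsto _).mono_left
      nhdsWithin_le_nhds
  · filter_upwards [self_mem_nhdsWithin] with m hm using h m hm

variable [CompleteSpace H]

/-! ### Commuting the factors of a product -/

/-- Bounded below means injective with closed range; for self-adjoint `R` the complement of the
range is `ker R = 0`. -/
theorem isUnit_of_isSelfAdjoint_of_bound {R : H →L[ℂ] H} (hR : IsSelfAdjoint R) {K : ℝ}
    (h : ∀ x, ‖x‖ ≤ K * ‖R x‖) : IsUnit R := by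
  have hanti : AntilipschitzWith K.toNNReal R :=
    ContinuousLinearMap.antilipschitz_of_bound R fun x => (h x).trans
      (by gcongr; exact Real.le_coe_toNNReal K)
  rw [ContinuousLinearMap.isUnit_iff_bijective,
    ContinuousLinearMap.bijective_iff_dense_range_and_antilipschitz]
  refine ⟨?_, _, hanti⟩
  rw [Submodule.topologicalClosure_eq_top_iff, ContinuousLinearMap.orthogonal_range,
    show ContinuousLinearMap.adjoint R = R from hR]
  exact LinearMap.ker_eq_bot.mpr hanti.injective

/-- The lower bounds make `l - S` invertible for every `l > c`, so the spectrum of `S` lies in `(-∞,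
c]`. -/
theorem re_inner_le_of_bound {S : H →L[ℂ] H} (hS : IsSelfAdjoint S) {c : ℝ}
    (h : ∀ l, c < l → ∃ K : ℝ, ∀ x, ‖x‖ ≤ K * ‖(l : ℂ) • x - S x‖) (x : H) :
    (⟪x, S x⟫_ℂ).re ≤ c * ‖x‖ ^ 2 := by
  have hle : S ≤ algebraMap ℝ (H →L[ℂ] H) c := by
    refine le_algebraMap_of_spectrum_le (fun l hl => ?_) hS
    by_contra hcl
    obtain ⟨K, hK⟩ := h l (not_le.mp hcl)
    refine hl (isUnit_of_isSelfAdjoint_of_bound (K := K)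
      ((IsSelfAdjoint.algebraMap _ (IsSelfAdjoint.all l)).sub hS) fun x => ?_)
    exact hK x
  have := ((ContinuousLinearMap.le_def _ _).mp hle).re_inner_nonneg_right x
  have e : ⟪x, ((algebraMap ℝ (H →L[ℂ] H) c) - S) x⟫_ℂ = c * ⟪x, x⟫_ℂ - ⟪x, S x⟫_ℂ := by
    rw [sub_apply, inner_sub_right, ← inner_smul_right]
    rfl
  rw [e, inner_self_eq_norm_sq_to_K] at this
  have e2 : ((c : ℂ) * ((‖x‖ : ℝ) : ℂ) ^ 2 - ⟪x, S x⟫_ℂ).re = c * ‖x‖ ^ 2 - (⟪x, S x⟫_ℂ).re := by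
    rw [Complex.sub_re, Complex.re_ofReal_mul]
    norm_cast
  have h3 : 0 ≤ ((c : ℂ) * ((‖x‖ : ℝ) : ℂ) ^ 2 - ⟪x, S x⟫_ℂ).re := this
  linarith

/-- The quadratic form of `AB + (AB)*` on the vector `x` is controlled through the vectors
`Bx` and `A*x`. -/
theorem two_re_inner_mul_le {A B : H →L[ℂ] H} {a b m : ℝ} (hm : 0 ≤ m)
    (ha : ‖A‖ ≤ a) (hb : ‖B‖ ≤ b) (h : ∀ x, ‖⟪x, (B * A) x⟫_ℂ‖ ≤ m * ‖x‖ ^ 2) (x : H) :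
    2 * (⟪x, (A * B) x⟫_ℂ).re ≤ (m + (a ^ 2 + b ^ 2) / 2) * ‖x‖ ^ 2 := by
  have ha0 := (norm_nonneg A).trans ha
  have hb0 := (norm_nonneg B).trans hb
  have hS : IsSelfAdjoint (A * B + star (A * B)) := IsSelfAdjoint.add_star_self _
  set c := m + (a ^ 2 + b ^ 2) / 2 with hc
  have hc0 : 0 ≤ c := by positivity
  have adj : ∀ (T : H →L[ℂ] H) (y z : H), ⟪y, star T z⟫_ℂ = ⟪T y, z⟫_ℂ := fun T y z =>
    ContinuousLinearMap.adjoint_inner_right T y z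
  have adjn : ∀ T : H →L[ℂ] H, ‖star T‖ = ‖T‖ := fun T => norm_star T
  have main := re_inner_le_of_bound hS (c := c) ?_ x
  · have e : (⟪x, (A * B + star (A * B)) x⟫_ℂ).re = 2 * (⟪x, (A * B) x⟫_ℂ).re := by
      rw [add_apply, inner_add_right, adj, Complex.add_re,
        ← inner_conj_symm ((A * B) x) x, Complex.conj_re]
      ring
    rwa [e] at main
  intro l hl
  have hl0 : 0 < l := hc0.trans_lt hl
  -- The constant combines `h5` with `h4`: `l‖x‖ ≤ ‖z‖ + (a + b)(‖p‖ + ‖q‖)`.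
  refine ⟨(1 + (a + b) * (2 * (a + b) / (l - c))) / l, fun x => ?_⟩
  set z := (l : ℂ) • x - (A * B + star (A * B)) x with hz
  set p := B x with hp
  set q := star A x with hq
  have hzx : (l : ℂ) • x = z + A p + star B q := by
    simp only [hz, hp, hq, star_mul, add_apply,
      mul_apply_eq_comp]
    abel
  -- Applying `B` and `A*` to `hzx` gives a closed system for `(p, q)` with operator matrix `[[BA,
  -- BB*], [A*A, (BA)*]]`. Its diagonal is governed by `w(BA)`, its off-diagonal entries by `b²` and
  -- `a²`.
  have hBz : (l : ℂ) • p = B z + B (A p) + B (star B q) := by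
    conv_lhs => rw [hp, ← map_smul, hzx, map_add, map_add]
  have hAz : (l : ℂ) • q = star A z + star A (A p) + star A (star B q) := by
    conv_lhs => rw [hq, ← map_smul, hzx, map_add, map_add]
  have hA : ∀ y, ‖A y‖ ≤ a * ‖y‖ := fun y => A.le_of_opNorm_le ha y
  have hB : ∀ y, ‖B y‖ ≤ b * ‖y‖ := fun y => B.le_of_opNorm_le hb y
  have hA' : ∀ y, ‖star A y‖ ≤ a * ‖y‖ := fun y =>
    (star A).le_of_opNorm_le ((adjn A).trans_le ha) y
  have hB' : ∀ y, ‖star B y‖ ≤ b * ‖y‖ := fun y =>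
    (star B).le_of_opNorm_le ((adjn B).trans_le hb) y
  have hcs : ∀ y z : H, (⟪y, z⟫_ℂ).re ≤ ‖y‖ * ‖z‖ := fun y z =>
    (Complex.re_le_norm _).trans (norm_inner_le_norm y z)
  have h1 : l * ‖p‖ ^ 2 ≤ ‖p‖ * (b * ‖z‖) + m * ‖p‖ ^ 2 + b ^ 2 * (‖p‖ * ‖q‖) := by
    have e : l * ‖p‖ ^ 2 = (⟪p, (l : ℂ) • p⟫_ℂ).re := by
      rw [inner_smul_right, Complex.re_ofReal_mul, ← inner_self_eq_norm_sq (𝕜 := ℂ) p]; rfl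
    rw [e, hBz, inner_add_right, inner_add_right, Complex.add_re, Complex.add_re]
    have i1 := (hcs p (B z)).trans (mul_le_mul_of_nonneg_left (hB z) (norm_nonneg p))
    have i2 := (Complex.re_le_norm _).trans (h p)
    have i3 : (⟪p, B (star B q)⟫_ℂ).re ≤ b ^ 2 * (‖p‖ * ‖q‖) := by
      refine (hcs p _).trans ?_
      calc ‖p‖ * ‖B (star B q)‖ ≤ ‖p‖ * (b * (b * ‖q‖)) := by
            gcongr; exact (hB _).trans (by gcongr; exact hB' q)
        _ = _ := by ring
    exact add_le_add (add_le_add i1 i2) i3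
  have h2 : l * ‖q‖ ^ 2 ≤ ‖q‖ * (a * ‖z‖) + a ^ 2 * (‖p‖ * ‖q‖) + m * ‖q‖ ^ 2 := by
    have e : l * ‖q‖ ^ 2 = (⟪q, (l : ℂ) • q⟫_ℂ).re := by
      rw [inner_smul_right, Complex.re_ofReal_mul, ← inner_self_eq_norm_sq (𝕜 := ℂ) q]; rfl
    rw [e, hAz, inner_add_right, inner_add_right, Complex.add_re, Complex.add_re]
    have i1 := (hcs q (star A z)).trans (mul_le_mul_of_nonneg_left (hA' z) (norm_nonneg q))
    have i2 : (⟪q, star A (star B q)⟫_ℂ).re ≤ m * ‖q‖ ^ 2 := by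
      rw [adj, adj, ← inner_conj_symm, Complex.conj_re]
      exact (Complex.re_le_norm _).trans (h q)
    have i3 : (⟪q, star A (A p)⟫_ℂ).re ≤ a ^ 2 * (‖p‖ * ‖q‖) := by
      refine (hcs q _).trans ?_
      calc ‖q‖ * ‖star A (A p)‖ ≤ ‖q‖ * (a * (a * ‖p‖)) := by
            gcongr; exact (hA' _).trans (by gcongr; exact hA p)
        _ = _ := by ring
    exact add_le_add (add_le_add i1 i3) i2
  -- Add `h1` and `h2`: the cross terms satisfy `(a² + b²)‖p‖‖q‖ ≤ (a² + b²)/2 · (‖p‖² + ‖q‖²)`,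
  -- which is where `c` comes from.
  have h3 : (l - c) * (‖p‖ + ‖q‖) ^ 2 ≤ 2 * (a + b) * ‖z‖ * (‖p‖ + ‖q‖) := by
    have e1 : (l - c) * (‖p‖ ^ 2 + ‖q‖ ^ 2) ≤ (a + b) * ‖z‖ * (‖p‖ + ‖q‖) := by
      have e2 : 0 ≤ (a ^ 2 + b ^ 2) / 2 * (‖p‖ - ‖q‖) ^ 2 := by positivity
      have e3 : 0 ≤ a * (‖z‖ * ‖p‖) + b * (‖z‖ * ‖q‖) := by positivity
      rw [hc]
      linarith
    have e4 : 0 ≤ (l - c) * (‖p‖ - ‖q‖) ^ 2 := mul_nonneg (sub_pos.mpr hl).le (sq_nonneg _)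
    linarith
  have h4 : ‖p‖ + ‖q‖ ≤ 2 * (a + b) / (l - c) * ‖z‖ := by
    have hlc := sub_pos.mpr hl
    rw [div_mul_eq_mul_div, le_div_iff₀ hlc]
    rcases (add_nonneg (norm_nonneg p) (norm_nonneg q)).eq_or_lt with h0 | h0
    · rw [← h0, zero_mul]; positivity
    · refine le_of_mul_le_mul_right ?_ h0
      linarith
  have h5 : l * ‖x‖ ≤ ‖z‖ + a * ‖p‖ + b * ‖q‖ := by
    calc l * ‖x‖ = ‖(l : ℂ) • x‖ := by
          rw [norm_smul, Complex.norm_real, Real.norm_of_nonneg hl0.le]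
      _ ≤ ‖z‖ + ‖A p‖ + ‖star B q‖ := by rw [hzx]; exact norm_add₃_le
      _ ≤ _ := by gcongr; exacts [hA p, hB' q]
  have h6 := mul_le_mul_of_nonneg_left h4 (add_nonneg ha0 hb0)
  rw [div_mul_eq_mul_div, le_div_iff₀ hl0]
  have h7 : 0 ≤ a * ‖q‖ + b * ‖p‖ := by positivity
  linarith

theorem two_mul_numericalRadius_mul_le (A B : H →L[ℂ] H) :
    2 * numericalRadius (A * B) ≤ numericalRadius (B * A) + ‖A‖ * ‖B‖ := by
  have hnn : 0 ≤ numericalRadius (B * A) + ‖A‖ * ‖B‖ :=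
    add_nonneg (numericalRadius_nonneg _) (by positivity)
  rcases eq_or_ne (‖A‖ * ‖B‖) 0 with h0 | h0
  · have : numericalRadius (A * B) ≤ 0 :=
      (numericalRadius_le_norm _).trans ((norm_mul_le A B).trans h0.le)
    linarith
  have hA : 0 < ‖A‖ := (norm_nonneg A).lt_of_ne' (left_ne_zero_of_mul h0)
  have hB : 0 < ‖B‖ := (norm_nonneg B).lt_of_ne' (right_ne_zero_of_mul h0)
  suffices h : numericalRadius (A * B) ≤ (numericalRadius (B * A) + ‖A‖ * ‖B‖) / 2 by linarith
  refine numericalRadius_le (by positivity) fun x => ?_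
  obtain ⟨u, hu, hux⟩ := exists_unit_mul_eq_norm ⟪x, (A * B) x⟫_ℂ
  -- Replacing `A, B` by `rA, r⁻¹B` equalizes their norms, so that `(a² + b²)/2` becomes exactly
  -- `‖A‖‖B‖`.
  set r : ℝ := √(‖B‖ / ‖A‖) with hr
  have hr0 : 0 < r := Real.sqrt_pos.mpr (div_pos hB hA)
  have hr2 : r ^ 2 = ‖B‖ / ‖A‖ := Real.sq_sqrt (by positivity)
  have hrc : (r : ℂ) ≠ 0 := by exact_mod_cast hr0.ne'
  have key := two_re_inner_mul_le (A := (u * r) • A) (B := ((r : ℂ)⁻¹) • B) (a := r * ‖A‖)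
    (b := r⁻¹ * ‖B‖) (m := numericalRadius (B * A)) (numericalRadius_nonneg _)
    (by rw [norm_smul, norm_mul, hu, Complex.norm_real, Real.norm_of_nonneg hr0.le, one_mul])
    (by rw [norm_smul, norm_inv, Complex.norm_real, Real.norm_of_nonneg hr0.le]) ?_ x
  · have e1 : ((u * r) • A) * ((r : ℂ)⁻¹ • B) = u • (A * B) := by
      rw [smul_mul_smul_comm]; congr 1; field_simp
    have e2 : ((r * ‖A‖) ^ 2 + (r⁻¹ * ‖B‖) ^ 2) / 2 = ‖A‖ * ‖B‖ := by
      rw [mul_pow, mul_pow, inv_pow, hr2]; field_simp; norm_num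
    rw [e1, e2, smul_apply, inner_smul_right, hux, Complex.ofReal_re] at key
    linarith
  · intro y
    have e1 : ((r : ℂ)⁻¹ • B) * ((u * r) • A) = u • (B * A) := by
      rw [smul_mul_smul_comm]; congr 1; field_simp
    rw [e1, smul_apply, inner_smul_right, norm_mul, hu, one_mul]
    exact norm_inner_le_numericalRadius _ y

/-! ### The numerical radius and the square -/

/-- For `S = uT` with a suitable phase `u`, `2|⟨Tx, x⟩| = ⟨(S + S*)x, x⟩`, and `(S + S*)² = S² + S*²
+ (S*S + SS*)`, whose last bracket does not depend on `u`. -/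
theorem four_mul_sq_numericalRadius_le (T : H →L[ℂ] H) :
    4 * numericalRadius T ^ 2 ≤
      2 * numericalRadius (T * T) + ‖star T * T + T * star T‖ := by
  set D := 2 * numericalRadius (T * T) + ‖star T * T + T * star T‖ with hD
  have hD0 : 0 ≤ D := add_nonneg (mul_nonneg two_pos.le (numericalRadius_nonneg _)) (norm_nonneg _)
  suffices h : numericalRadius T ≤ √D / 2 by
    calc 4 * numericalRadius T ^ 2 ≤ 4 * (√D / 2) ^ 2 := by
          gcongr; exact numericalRadius_nonneg T
      _ = D := by rw [div_pow, Real.sq_sqrt hD0]; ring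
  refine numericalRadius_le (by positivity) fun x => ?_
  obtain ⟨u, hu, hux⟩ := exists_unit_mul_eq_norm ⟪x, T x⟫_ℂ
  have adj : ∀ (T : H →L[ℂ] H) (y z : H), ⟪y, star T z⟫_ℂ = ⟪T y, z⟫_ℂ := fun T y z =>
    ContinuousLinearMap.adjoint_inner_right T y z
  set S := u • T with hS
  have hSx : ⟪x, S x⟫_ℂ = (‖⟪x, T x⟫_ℂ‖ : ℂ) := by
    rw [hS, smul_apply, inner_smul_right, hux]
  have huu : star u * u = 1 := by
    have := Complex.conj_mul' u
    rw [hu] at this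
    simpa using this
  have hSS : star S * S + S * star S = star T * T + T * star T := by
    rw [hS, star_smul, smul_mul_smul_comm, smul_mul_smul_comm, mul_comm u, huu, one_smul, one_smul]
  have h1 : 2 * ‖⟪x, T x⟫_ℂ‖ ≤ ‖x‖ * ‖S x + star S x‖ := by
    refine le_trans ?_ ((Complex.re_le_norm _).trans (norm_inner_le_norm x (S x + star S x)))
    rw [inner_add_right, adj, ← inner_conj_symm (S x) x, Complex.add_re, Complex.conj_re, hSx,
      Complex.ofReal_re]
    linarith
  have h2 : ‖S x + star S x‖ ^ 2 ≤ D * ‖x‖ ^ 2 := by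
    have e : ‖S x + star S x‖ ^ 2 =
        2 * (⟪x, (S * S) x⟫_ℂ).re + (⟪x, (star S * S + S * star S) x⟫_ℂ).re := by
      have e1 : ⟪star S x, star S x⟫_ℂ = ⟪x, S (star S x)⟫_ℂ :=
        ContinuousLinearMap.adjoint_inner_left S (star S x) x
      have e2 : ⟪star S x, S x⟫_ℂ = ⟪x, S (S x)⟫_ℂ :=
        ContinuousLinearMap.adjoint_inner_left S (S x) x
      have e3 : ⟪S x, star S x⟫_ℂ = starRingEnd ℂ ⟪x, S (S x)⟫_ℂ := by
        rw [adj, inner_conj_symm]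
      have e4 : ⟪x, star S (S x)⟫_ℂ = ⟪S x, S x⟫_ℂ := adj S x (S x)
      rw [← inner_self_eq_norm_sq (𝕜 := ℂ)]
      simp only [inner_add_left, inner_add_right, e1, e2, e3, e4, add_apply,
        mul_apply_eq_comp, Complex.add_re, map_add, RCLike.re_to_complex, Complex.conj_re]
      ring
    have i1 : (⟪x, (S * S) x⟫_ℂ).re ≤ numericalRadius (T * T) * ‖x‖ ^ 2 := by
      refine (Complex.re_le_norm _).trans ?_
      rw [hS, smul_mul_smul_comm, smul_apply, inner_smul_right, norm_mul, norm_mul, hu, one_mul,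
        one_mul]
      exact norm_inner_le_numericalRadius _ x
    have i2 := (Complex.re_le_norm _).trans (norm_inner_apply_le (star S * S + S * star S) x)
    rw [hSS] at i2 e
    rw [e, hD]
    linarith
  have h3 : ‖S x + star S x‖ ≤ √D * ‖x‖ := by
    rw [← Real.sqrt_sq (norm_nonneg x), ← Real.sqrt_mul hD0]
    exact Real.le_sqrt_of_sq_le h2
  calc ‖⟪x, T x⟫_ℂ‖ ≤ ‖x‖ * ‖S x + star S x‖ / 2 := by linarith
    _ ≤ ‖x‖ * (√D * ‖x‖) / 2 := by gcongr
    _ = _ := by ring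

/-! ### The Aluthge transform -/

theorem IsPolarPart.norm_le_one {T U : H →L[ℂ] H} (hU : IsPolarPart T U) : ‖U‖ ≤ 1 := by
  refine U.opNorm_le_bound zero_le_one fun x => ?_
  have : CompleteSpace U.ker := U.isClosed_ker.completeSpace_coe
  obtain ⟨y, hy, z, hz, rfl⟩ := U.ker.exists_add_mem_mem_orthogonal x
  have h0 : U y = 0 := hy
  rw [map_add, h0, zero_add, hU.isometric z hz, one_mul]
  have hyz : ⟪y, z⟫_ℂ = 0 := Submodule.inner_right_of_mem_orthogonal hy hz
  have := norm_add_sq_eq_norm_sq_add_norm_sq_of_inner_eq_zero y z hyz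
  exact abs_le_of_sq_le_sq' (by nlinarith [mul_self_nonneg ‖y‖]) (norm_nonneg _) |>.2

/-- Equality case of Cauchy–Schwarz: `⟨U*Ux, x⟩ = ‖x‖²` and `‖U*Ux‖ ≤ ‖x‖` force `‖U*Ux - x‖² ≤ 0`.
-/
theorem IsPolarPart.star_mul_self_apply {T U : H →L[ℂ] H} (hU : IsPolarPart T U) {x : H}
    (hx : x ∈ U.kerᗮ) : (star U * U) x = x := by
  have e : ⟪(star U * U) x, x⟫_ℂ = (‖x‖ : ℂ) ^ 2 := by
    have : ⟪(star U * U) x, x⟫_ℂ = ⟪U x, U x⟫_ℂ :=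
      ContinuousLinearMap.adjoint_inner_left U x (U x)
    rw [this, inner_self_eq_norm_sq_to_K, hU.isometric x hx]; rfl
  have hn : ‖(star U * U) x‖ ≤ ‖x‖ := by
    refine (ContinuousLinearMap.le_of_opNorm_le _ (c := 1) ?_ x).trans_eq (one_mul _)
    rw [CStarRing.norm_star_mul_self]
    nlinarith [hU.norm_le_one, norm_nonneg U]
  have h := norm_sub_sq (𝕜 := ℂ) ((star U * U) x) x
  rw [e] at h
  have hre : RCLike.re ((‖x‖ : ℂ) ^ 2) = ‖x‖ ^ 2 := by
    rw [RCLike.re_to_complex]; norm_cast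
  rw [hre] at h
  have h2 : ‖(star U * U) x‖ ^ 2 ≤ ‖x‖ ^ 2 := by gcongr
  have h3 : ‖(star U * U) x - x‖ ^ 2 = 0 := le_antisymm (by linarith) (sq_nonneg _)
  exact sub_eq_zero.mp (norm_eq_zero.mp (pow_eq_zero_iff two_ne_zero |>.mp h3))

theorem star_polarPart_mul_self_mul_abs (T : H →L[ℂ] H) :
    star (polarPart T) * polarPart T * CFC.abs T = CFC.abs T := by
  have hU := isPolarPart_polarPart T
  ext x
  refine hU.star_mul_self_apply (x := CFC.abs T x) ?_
  rw [hU.ker_eq, ← orthogonal_range_abs]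
  exact Submodule.le_orthogonal_orthogonal _ (LinearMap.mem_range_self _ x)

theorem abs_mul_star_polarPart_mul_self (T : H →L[ℂ] H) :
    CFC.abs T * (star (polarPart T) * polarPart T) = CFC.abs T := by
  have h := congrArg star (star_polarPart_mul_self_mul_abs T)
  rwa [star_mul, star_mul, star_star, (CFC.abs_nonneg T).isSelfAdjoint.star_eq] at h

theorem absPow_zero (T : H →L[ℂ] H) : absPow T 0 = star (polarPart T) * polarPart T :=
  if_pos rfl

theorem absPow_one (T : H →L[ℂ] H) : absPow T 1 = CFC.abs T := by
  rw [absPow, if_neg one_ne_zero, CFC.rpow_one _ (CFC.abs_nonneg T)]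

/-- At `t = 0` and `t = 1` the convention `|T|^0 = U*U` is harmless because `U*U` fixes the range of
`|T|`. In between, both exponents are positive and add without `|T|` being invertible. -/
theorem absPow_mul_absPow {t : ℝ} (ht : t ∈ Set.Icc (0 : ℝ) 1) (T : H →L[ℂ] H) :
    absPow T (1 - t) * absPow T t = CFC.abs T := by
  rcases ht.1.eq_or_lt with rfl | h0
  · rw [sub_zero, absPow_one, absPow_zero, abs_mul_star_polarPart_mul_self]
  rcases ht.2.eq_or_lt with rfl | h1
  · rw [sub_self, absPow_one, absPow_zero, star_polarPart_mul_self_mul_abs]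
  lift t to NNReal using h0.le
  have h0' : 0 < t := by exact_mod_cast h0
  have h1' : t < 1 := by exact_mod_cast h1
  have e : (1 : ℝ) - t = ((1 - t : NNReal) : ℝ) := by rw [NNReal.coe_sub h1'.le]; rfl
  rw [absPow, absPow, if_neg (sub_pos.mpr h1).ne', if_neg h0.ne', e,
    ← CFC.nnrpow_eq_rpow (tsub_pos_of_lt h1'), ← CFC.nnrpow_eq_rpow h0',
    ← CFC.nnrpow_add (tsub_pos_of_lt h1') h0', tsub_add_cancel_of_le h1'.le,
    CFC.nnrpow_one _ (CFC.abs_nonneg T)]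

theorem norm_absPow_le {s : ℝ} (hs : 0 ≤ s) (T : H →L[ℂ] H) : ‖absPow T s‖ ≤ ‖T‖ ^ s := by
  rcases hs.eq_or_lt with rfl | h
  · rw [absPow_zero, CStarRing.norm_star_mul_self, Real.rpow_zero]
    have := (isPolarPart_polarPart T).norm_le_one
    exact mul_le_one₀ this (norm_nonneg _) this
  · rw [absPow, if_neg h.ne', CFC.norm_rpow _ h (CFC.abs_nonneg T), CFC.norm_abs]

theorem norm_absPow_mul_norm_absPow_le {t : ℝ} (ht : t ∈ Set.Icc (0 : ℝ) 1) (T : H →L[ℂ] H) :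
    ‖absPow T (1 - t)‖ * ‖absPow T t‖ ≤ ‖T‖ := by
  calc ‖absPow T (1 - t)‖ * ‖absPow T t‖ ≤ ‖T‖ ^ (1 - t) * ‖T‖ ^ t := by
        gcongr
        exacts [norm_absPow_le (sub_nonneg.mpr ht.2) T, norm_absPow_le ht.1 T]
    _ = ‖T‖ := by
        -- The exponents sum to `1 ≠ 0`, so `‖T‖ = 0` needs no separate case.
        rw [← Real.rpow_add' (norm_nonneg T) (by simp), sub_add_cancel, Real.rpow_one]

theorem norm_aluthge_le {t : ℝ} (ht : t ∈ Set.Icc (0 : ℝ) 1) (T : H →L[ℂ] H) :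
    ‖aluthge t T‖ ≤ ‖T‖ := by
  calc ‖aluthge t T‖ ≤ ‖absPow T t‖ * ‖polarPart T‖ * ‖absPow T (1 - t)‖ := norm_mul₃_le
    _ ≤ ‖absPow T t‖ * 1 * ‖absPow T (1 - t)‖ := by
        gcongr; exact (isPolarPart_polarPart T).norm_le_one
    _ = ‖absPow T (1 - t)‖ * ‖absPow T t‖ := by ring
    _ ≤ ‖T‖ := norm_absPow_mul_norm_absPow_le ht T

theorem two_mul_numericalRadius_mul_self_le {t : ℝ} (ht : t ∈ Set.Icc (0 : ℝ) 1)
    (T : H →L[ℂ] H) :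
    2 * numericalRadius (T * T) ≤ numericalRadius (aluthge t T) ^ 2 + ‖T‖ * ‖aluthge t T‖ := by
  set P := absPow T t
  set Q := absPow T (1 - t)
  set U := polarPart T
  have hQP : Q * P = CFC.abs T := absPow_mul_absPow ht T
  have hT : T = U * (Q * P) := by rw [hQP]; exact (isPolarPart_polarPart T).factor
  have h1 : U * Q * aluthge t T * P = T * T := by
    conv_rhs => rw [hT]
    simp only [aluthge, P, Q, U, mul_assoc]
  have h2 : P * (U * Q * aluthge t T) = aluthge t T * aluthge t T := by
    simp only [aluthge, P, Q, U, mul_assoc]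
  have key := two_mul_numericalRadius_mul_le (U * Q * aluthge t T) P
  rw [h1, h2] at key
  have hn : ‖U * Q * aluthge t T‖ * ‖P‖ ≤ ‖T‖ * ‖aluthge t T‖ := by
    calc ‖U * Q * aluthge t T‖ * ‖P‖ ≤ ‖U‖ * ‖Q‖ * ‖aluthge t T‖ * ‖P‖ := by
          gcongr; exact norm_mul₃_le
      _ ≤ 1 * ‖Q‖ * ‖aluthge t T‖ * ‖P‖ := by
          gcongr; exact (isPolarPart_polarPart T).norm_le_one
      _ = ‖Q‖ * ‖P‖ * ‖aluthge t T‖ := by ring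
      _ ≤ ‖T‖ * ‖aluthge t T‖ := by gcongr; exact norm_absPow_mul_norm_absPow_le ht T
  linarith [numericalRadius_mul_self_le (aluthge t T)]

theorem four_mul_sq_numericalRadius_le_aluthge {t : ℝ} (ht : t ∈ Set.Icc (0 : ℝ) 1)
    (T : H →L[ℂ] H) :
    4 * numericalRadius T ^ 2 ≤ numericalRadius (aluthge t T) ^ 2 +
      (‖T‖ * ‖aluthge t T‖ + ‖star T * T + T * star T‖) := by
  linarith [four_mul_sq_numericalRadius_le T, two_mul_numericalRadius_mul_self_le ht T]

/-! ### The iteration -/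

theorem norm_iteratedAluthge_le {t : ℝ} (ht : t ∈ Set.Icc (0 : ℝ) 1) (T : H →L[ℂ] H) (n : ℕ) :
    ‖iteratedAluthge t T n‖ ≤ ‖T‖ := by
  induction n with
  | zero => exact le_rfl
  | succ n ih => exact (norm_aluthge_le ht _).trans ih

theorem iterateTerm_nonneg (t : ℝ) (T : H →L[ℂ] H) (k : ℕ) : 0 ≤ iterateTerm t T k := by
  rw [iterateTerm]; positivity

theorem iterateTerm_le {t : ℝ} (ht : t ∈ Set.Icc (0 : ℝ) 1) (T : H →L[ℂ] H) (k : ℕ) :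
    iterateTerm t T k ≤ (1 / 4) ^ k * (3 / 4 * ‖T‖ ^ 2) := by
  have h := norm_iteratedAluthge_le ht T
  set S := iteratedAluthge t T k
  have h1 : ‖S‖ * ‖iteratedAluthge t T (k + 1)‖ ≤ ‖T‖ ^ 2 := by
    rw [sq]; exact mul_le_mul (h k) (h (k + 1)) (norm_nonneg _) (norm_nonneg _)
  have h2 : ‖star S * S + S * star S‖ ≤ ‖T‖ ^ 2 + ‖T‖ ^ 2 := by
    refine norm_add_le_of_le ?_ ?_
    · rw [CStarRing.norm_star_mul_self, sq]
      exact mul_self_le_mul_self (norm_nonneg _) (h k)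
    · rw [CStarRing.norm_self_mul_star, sq]
      exact mul_self_le_mul_self (norm_nonneg _) (h k)
  calc iterateTerm t T k ≤ 1 / 4 ^ (k + 1) * (‖T‖ ^ 2 + (‖T‖ ^ 2 + ‖T‖ ^ 2)) := by
        rw [iterateTerm]; gcongr
    _ = _ := by rw [one_div_pow, pow_succ]; ring

theorem summable_iterateTerm {t : ℝ} (ht : t ∈ Set.Icc (0 : ℝ) 1) (T : H →L[ℂ] H) :
    Summable (iterateTerm t T) :=
  Summable.of_nonneg_of_le (iterateTerm_nonneg t T) (iterateTerm_le ht T)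
    ((summable_geometric_of_lt_one (by norm_num) (by norm_num)).mul_right _)

/-- The one-step inequality, scaled by `4^{-(n+1)}`, converts the remainder at stage `n` into the
summand of index `n` plus the next remainder. -/
theorem sq_numericalRadius_le_sum_range {t : ℝ} (ht : t ∈ Set.Icc (0 : ℝ) 1) (T : H →L[ℂ] H)
    (n : ℕ) :
    numericalRadius T ^ 2 ≤ ∑ k ∈ Finset.range n, iterateTerm t T k +
      (1 / 4) ^ n * numericalRadius (iteratedAluthge t T n) ^ 2 := by
  induction n with
  | zero => simp [iteratedAluthge]
  | succ n ih =>
    refine ih.trans ?_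
    rw [Finset.sum_range_succ, add_assoc]
    gcongr
    have h := four_mul_sq_numericalRadius_le_aluthge ht (iteratedAluthge t T n)
    have h' := mul_le_mul_of_nonneg_left h (by positivity : (0 : ℝ) ≤ (1 / 4) ^ (n + 1))
    calc (1 / 4 : ℝ) ^ n * numericalRadius (iteratedAluthge t T n) ^ 2
        = (1 / 4) ^ (n + 1) * (4 * numericalRadius (iteratedAluthge t T n) ^ 2) := by
          rw [pow_succ]; ring
      _ ≤ _ := h'
      _ = _ := by rw [iterateTerm, iteratedAluthge, one_div_pow]; ring

end

end AluthgeIteration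

open AluthgeIteration Filter Topology in
theorem mainTheorem5 {H : Type*} [NormedAddCommGroup H] [InnerProductSpace ℂ H] [CompleteSpace H]
    (T : H →L[ℂ] H) (t : ℝ) (ht : t ∈ Set.Icc (0 : ℝ) 1) :
    Summable (AluthgeIteration.iterateTerm t T) ∧
      AluthgeIteration.numericalRadius T ^ 2 ≤ ∑' k : ℕ, AluthgeIteration.iterateTerm t T k := by
  have hs := summable_iterateTerm ht T
  refine ⟨hs, ?_⟩
  have h0 : Tendsto (fun n : ℕ => (1 / 4 : ℝ) ^ n * ‖T‖ ^ 2) atTop (𝓝 0) := by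
    simpa using (tendsto_pow_atTop_nhds_zero_of_lt_one (r := (1 / 4 : ℝ)) (by norm_num)
      (by norm_num)).mul_const (‖T‖ ^ 2)
  have hlim := hs.hasSum.tendsto_sum_nat.add h0
  rw [add_zero] at hlim
  refine ge_of_tendsto' hlim fun n => (sq_numericalRadius_le_sum_range ht T n).trans ?_
  gcongr
  exacts [numericalRadius_nonneg _,
    (numericalRadius_le_norm _).trans (norm_iteratedAluthge_le ht T n)]
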